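/- Let $K$ be an infinite field of characteristic different from $2$ and $3$, and let $F=K\langle x_1,x_2,\dots\rangle$ be the free associative unital $K$-algebra of countable rank. Put $[u,v]=uv-vu$ and $[a_1,\dots,a_n]=[[a_1,\dots,a_{n-1}],a_n]$. Let $T^{(n)}$ be the T-ideal of $F$ generated by $[x_1,\dots,x_n]$, that is, the two-sided ideal generated by all $\varphi([x_1,\dots,x_n])$, where $\varphi$ runs over the unital $K$-algebra endomorphisms of $F$. Put $F^{(n)}=F/T^{(n)}$, and let $F_r^{(n)}$ be the subalgebra of $F^{(n)}$ generated by the images of $x_1,\dots,x_r$. Let $n\ge 3$. Then: 1. For any two distinct free generators $x,y$ of $F$ one has $[x,y]^{n-1}\in T^{(n)}$ and $[x,y]^{n-2}\notin T^{(n)}$; that is, the nilpotency index of the commutator of two distinct free generators of $F^{(n)}$ (the least $k$ such that its $k$-th power is $0$) is exactly $n-1$. 2. For $r=2$ and $r=3$, the commutator ideal $I$ of $F_r^{(n)}$ (the two-sided ideal generated by all commutators $[a,b]$, $a,b\in F_r^{(n)}$) is nilpotent of index exactly $n-1$: the least $k$ with $I^k=0$ is $n-1$. -/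

import Mathlib

/-- The left-normed commutator `[a 0, a 1, …, a (n - 1)]` of degree `n`:
`[a 0] = a 0` and `[a 0, …, a n] = [[a 0, …, a (n - 1)], a n]`, where `⁅u, v⁆ = u * v - v * u`.
The value in degree `0` is a placeholder. -/
def longComm {A : Type*} [Ring A] (a : ℕ → A) : ℕ → A
  | 0 => 0
  | 1 => a 0
  | n + 2 => ⁅longComm a (n + 1), a (n + 1)⁆

/-- The T-ideal of the free algebra `K⟨X⟩` generated by `f`: the two-sided ideal generated by
the images of `f` under all (unital) endomorphisms of `K⟨X⟩`. -/
def tIdeal {K X : Type*} [Field K] (f : FreeAlgebra K X) : TwoSidedIdeal (FreeAlgebra K X) :=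
  TwoSidedIdeal.span {g | ∃ φ : FreeAlgebra K X →ₐ[K] FreeAlgebra K X, g = φ f}

/-- `T^{(n)}`: the T-ideal of the free algebra of countable rank generated by the commutator
of degree `n` in the free generators. -/
def lieNilpTIdeal (K : Type*) [Field K] (n : ℕ) : TwoSidedIdeal (FreeAlgebra K ℕ) :=
  tIdeal (longComm (FreeAlgebra.ι K) n)

/-- `F^{(n)} = F / T^{(n)}`: the relatively free algebra of countable rank with the identity
`[x₁, …, xₙ] = 0`. -/
abbrev RelFree (K : Type*) [Field K] (n : ℕ) : Type _ :=
  (lieNilpTIdeal K n).ringCon.Quotient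

/-- The `i`-th free generator of `F^{(n)}` (generators are numbered from `0`). -/
def relGen (K : Type*) [Field K] (n i : ℕ) : RelFree K n :=
  (lieNilpTIdeal K n).ringCon.mk' (FreeAlgebra.ι K i)

/-- `F_r^{(n)}`: the subalgebra of `F^{(n)}` generated by the first `r` free generators. -/
def relFreeRank (K : Type*) [Field K] (r n : ℕ) : Subalgebra K (RelFree K n) :=
  Algebra.adjoin K (relGen K n '' {i | i < r})

/-- The commutator ideal of a `K`-algebra `A` (the two-sided ideal generated by all commutators),
as a `K`-subspace of `A`, so that its powers are the powers in the semiring `Submodule K A`. -/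
def commutatorIdeal (K A : Type*) [Field K] [Ring A] [Algebra K A] : Submodule K A :=
  (TwoSidedIdeal.asIdeal (TwoSidedIdeal.span {c : A | ∃ a b : A, c = ⁅a, b⁆})).restrictScalars K

/-! Let T_k be the ideal generated by commutators of degree k, so that `commSeries k` is T_{k+1}.
Upper bound: if 6 is invertible, T_3 T_k ⊆ T_{k+2} in every algebra (`commSeries_two_mul_le`). With
three generators also T_2 T_2 ⊆ T_3 (`commSeries_one_mul_le`), since two commutators of generators
then share an entry. Pairing the factors of I^m gives I^m ⊆ T_{m+1}, which vanishes in F_r^{(n)} for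
m = n - 1. The power of [x, y] is handled inside the subalgebra generated by x and y. Lower bound:
let x, y act on K[h][t] as h ∂/∂t and t. Commutators in the image are divisible by the central
element h, so T^{(n)} maps to multiples of h^{n-1}, whereas [x, y]^{n-2} maps to h^{n-2}. -/

/-- Up to sign, D is a function g on the edges {c, d} of the complete graph on five letters, and
`hJ` says that g sums to zero on triangles. Comparing the four triangles on four vertices shows that
2g agrees on disjoint edges, hence on all edges; a triangle then gives 6g = 0. -/
theorem six_nsmul_eq_zero_of_alternating {X V : Type*} [AddCommGroup V]
    (D : X → X → X → X → X → V)
    (h₁ : ∀ a b e c d, D a b e c d = -D b a e c d)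
    (h₂ : ∀ a b e c d, D a b e c d = -D e b a c d)
    (h₃ : ∀ a b e c d, D a b e c d = -D a b e d c)
    (hJ : ∀ a b e c d, D a b e c d + D a c e d b + D a d e b c = 0) (a b e c d : X) :
    (6 : ℕ) • D a b e c d = 0 := by
  linear_combination (norm := module)
    2 • hJ b e a c d + 2 • hJ a b e c d + hJ a b c e d + hJ d b a e c - 2 • hJ b a e c d - hJ
    b a c e d - hJ d a b e c - hJ c a e b d + hJ d a e b c + 2 • hJ d a c b e - 2 • h₁ b e a c
    d + 2 • h₂ e b a c d - 2 • h₁ b c a d e + 2 • h₂ c b a d e - 2 • h₃ a b c d e - 2 • h₁ a c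
    e d b - h₁ a e c d b + h₂ e a c d b - h₁ d b a e c - h₁ d e a c b + h₂ e d a c b - h₃ a d
    e c b - h₁ d c a b e + h₂ c d a b e + 2 • h₁ b a e c d + 2 • h₁ b c e d a + 2 • h₃ b d e a
    c + h₁ b a c e d + h₁ b e c d a - h₂ e b c d a + h₁ d a b e c - h₂ a d b e c + h₁ d e b c
    a - h₂ e d b c a + h₁ d c b a e - h₂ c d b a e + h₃ c a e b d - h₁ d a e b c - h₁ d b e c
    a - h₁ d c e a b - 2 • h₁ d a c b e - 2 • h₁ d b c e a + 2 • h₃ b d c e a - 2 • h₁ d e c a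
    b + 2 • h₂ e d c a b

theorem ring_add_lie {B : Type*} [Ring B] (x y z : B) : ⁅x + y, z⁆ = ⁅x, z⁆ + ⁅y, z⁆ := by
  simp only [Ring.lie_def]; noncomm_ring

theorem ring_lie_add {B : Type*} [Ring B] (x y z : B) : ⁅x, y + z⁆ = ⁅x, y⁆ + ⁅x, z⁆ := by
  simp only [Ring.lie_def]; noncomm_ring

theorem ring_smul_lie {K B : Type*} [Field K] [Ring B] [Algebra K B] (c : K) (x y : B) :
    ⁅c • x, y⁆ = c • ⁅x, y⁆ := by
  simp [Ring.lie_def, smul_sub]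

theorem ring_lie_smul {K B : Type*} [Field K] [Ring B] [Algebra K B] (c : K) (x y : B) :
    ⁅x, c • y⁆ = c • ⁅x, y⁆ := by
  simp [Ring.lie_def, smul_sub]

theorem ring_lie_skew {B : Type*} [Ring B] (x y : B) : -⁅y, x⁆ = ⁅x, y⁆ := by
  simp [Ring.lie_def]

/-! ### Lower central series, and products with commutators of degree three -/

/-- The lower central series of the Lie algebra of `B`, as subspaces:
`lieSeries K B k` is spanned by the left-normed commutators of degree `k + 1`. -/
def lieSeries (K B : Type*) [Field K] [Ring B] [Algebra K B] : ℕ → Submodule K B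
  | 0 => ⊤
  | k + 1 => Submodule.span K {w | ∃ u ∈ lieSeries K B k, ∃ v, w = ⁅u, v⁆}

section LieSeries

variable {K B : Type*} [Field K] [Ring B] [Algebra K B]

theorem lie_mem_lieSeries {k : ℕ} {u : B} (hu : u ∈ lieSeries K B k) (v : B) :
    ⁅u, v⁆ ∈ lieSeries K B (k + 1) :=
  Submodule.subset_span ⟨u, hu, v, rfl⟩

theorem lie_mem_lieSeries' {k : ℕ} {u : B} (hu : u ∈ lieSeries K B k) (v : B) :
    ⁅v, u⁆ ∈ lieSeries K B (k + 1) := by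
  rw [← ring_lie_skew]
  exact neg_mem (lie_mem_lieSeries hu v)

theorem lieSeries_succ_le (k : ℕ) : lieSeries K B (k + 1) ≤ lieSeries K B k := by
  induction k with
  | zero => exact le_top
  | succ k ih =>
    refine Submodule.span_le.2 ?_
    rintro _ ⟨u, hu, v, rfl⟩
    exact lie_mem_lieSeries (ih hu) v

theorem lieSeries_lie_lieSeries {j k : ℕ} {u v : B} (hu : u ∈ lieSeries K B j)
    (hv : v ∈ lieSeries K B k) : ⁅u, v⁆ ∈ lieSeries K B (j + k + 1) := by
  induction k generalizing j u v with
  | zero => exact lie_mem_lieSeries hu v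
  | succ k ih =>
    induction hv using Submodule.span_induction with
    | mem w hw =>
      obtain ⟨v, hv, w, rfl⟩ := hw
      have h : ⁅u, ⁅v, w⁆⁆ = ⁅⁅u, v⁆, w⁆ - ⁅⁅u, w⁆, v⁆ := by
        simp only [Ring.lie_def]; noncomm_ring
      rw [h]
      refine sub_mem (lie_mem_lieSeries (ih hu hv) w) ?_
      have := ih (lie_mem_lieSeries hu w) hv
      rwa [show j + 1 + k + 1 = j + (k + 1) + 1 by ring] at this
    | zero => simp [Ring.lie_def]
    | add x y _ _ hx hy => rw [ring_lie_add]; exact add_mem hx hy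
    | smul c x _ hx =>
      rw [ring_lie_smul]
      exact Submodule.smul_mem _ c hx

theorem lieSeries_le_span_longComm (k : ℕ) :
    lieSeries K B k ≤ Submodule.span K {w | ∃ a : ℕ → B, w = longComm a (k + 1)} := by
  induction k with
  | zero => exact fun w _ => Submodule.subset_span ⟨fun _ => w, rfl⟩
  | succ k ih =>
    refine Submodule.span_le.2 ?_
    rintro _ ⟨u, hu, v, rfl⟩
    replace hu := ih hu
    induction hu using Submodule.span_induction with
    | mem w hw =>
      obtain ⟨a, rfl⟩ := hw
      -- `longComm a (k + 1)` reads only the entries 0, …, k, so entry k + 1 is free to hold v.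
      refine Submodule.subset_span ⟨Function.update a (k + 1) v, ?_⟩
      have key (m : ℕ) (hm : m ≤ k + 1) :
          longComm (Function.update a (k + 1) v) m = longComm a m := by
        induction m using longComm.induct with
        | case1 => rfl
        | case2 => simp [longComm]
        | case3 m ihm =>
          rw [longComm, longComm, ihm (by omega), Function.update_of_ne (by omega)]
      rw [longComm, key _ le_rfl, Function.update_self]
    | zero => simp [Ring.lie_def]
    | add x y _ _ hx hy => rw [ring_add_lie]; exact add_mem hx hy
    | smul c x _ hx => rw [ring_smul_lie]; exact Submodule.smul_mem _ c hx

/-- Modulo `lieSeries K B 3` the expression is alternating in a, b, e and in c, d, and satisfies the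
Jacobi identity in b, c, d; so 6 kills it. -/
theorem lie_mul_lie_lie_mem (h2 : (2 : K) ≠ 0) (h3 : (3 : K) ≠ 0) (a b c d e : B) :
    ⁅a * ⁅b, ⁅c, d⁆⁆, e⁆ ∈ lieSeries K B 3 := by
  have m1 (x y : B) : ⁅x, y⁆ ∈ lieSeries K B 1 := lie_mem_lieSeries (k := 0) trivial y
  have key := six_nsmul_eq_zero_of_alternating
    (fun a b e c d : B => (lieSeries K B 3).mkQ ⁅a * ⁅b, ⁅c, d⁆⁆, e⁆) ?_ ?_ ?_ ?_ a b e c d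
  · have h6 : (6 : K) ≠ 0 := by
      rw [show (6 : K) = 2 * 3 by norm_num]; exact mul_ne_zero h2 h3
    rw [← Nat.cast_smul_eq_nsmul K, Nat.cast_ofNat, smul_eq_zero_iff_right h6] at key
    simpa using key
  · intro a b e c d
    rw [eq_neg_iff_add_eq_zero, ← map_add, Submodule.mkQ_apply, Submodule.Quotient.mk_eq_zero]
    have h : ⁅a * ⁅b, ⁅c, d⁆⁆, e⁆ + ⁅b * ⁅a, ⁅c, d⁆⁆, e⁆
        = ⁅⁅a * b, ⁅c, d⁆⁆, e⁆ - ⁅⁅⁅a, ⁅c, d⁆⁆, b⁆, e⁆ := by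
      simp only [Ring.lie_def]; noncomm_ring
    rw [h]
    exact sub_mem (lie_mem_lieSeries (lie_mem_lieSeries' (m1 c d) _) e) <|
      lieSeries_succ_le _ <|
        lie_mem_lieSeries (lie_mem_lieSeries (lie_mem_lieSeries' (m1 c d) a) b) e
  · intro a b e c d
    rw [eq_neg_iff_add_eq_zero, ← map_add, Submodule.mkQ_apply, Submodule.Quotient.mk_eq_zero]
    have hu : ⁅b, ⁅c, d⁆⁆ ∈ lieSeries K B 2 := lie_mem_lieSeries' (m1 c d) b
    generalize ⁅b, ⁅c, d⁆⁆ = u at hu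
    have h : ⁅a * u, e⁆ + ⁅e * u, a⁆ = ⁅u, a * e⁆ - ⁅⁅u, a⁆, e⁆ := by
      simp only [Ring.lie_def]; noncomm_ring
    rw [h]
    exact sub_mem (lie_mem_lieSeries hu _) <|
      lieSeries_succ_le _ <| lie_mem_lieSeries (lie_mem_lieSeries hu a) e
  · intro a b e c d
    rw [← map_neg]
    congr 1
    simp only [Ring.lie_def]; noncomm_ring
  · intro a b e c d
    rw [← map_add, ← map_add]
    convert map_zero (lieSeries K B 3).mkQ
    simp only [Ring.lie_def]; noncomm_ring

theorem lie_mul_mem_lieSeries_three (h2 : (2 : K) ≠ 0) (h3 : (3 : K) ≠ 0) {u : B}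
    (hu : u ∈ lieSeries K B 2) (x e : B) : ⁅u * x, e⁆ ∈ lieSeries K B 3 := by
  have h : ⁅u * x, e⁆ = ⁅x * u, e⁆ + ⁅⁅u, x⁆, e⁆ := by
    simp only [Ring.lie_def]; noncomm_ring
  rw [h]
  refine add_mem ?_ (lieSeries_succ_le _ <| lie_mem_lieSeries (lie_mem_lieSeries hu x) e)
  clear h
  induction hu using Submodule.span_induction with
  | mem u hu =>
    obtain ⟨v, hv, y, rfl⟩ := hu
    induction hv using Submodule.span_induction with
    | mem v hv =>
      obtain ⟨c, -, d, rfl⟩ := hv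
      rw [← ring_lie_skew _ y, mul_neg, ← neg_one_smul K, ring_smul_lie]
      exact Submodule.smul_mem _ _ (lie_mul_lie_lie_mem h2 h3 x y c d e)
    | zero => simp [Ring.lie_def]
    | add p q _ _ hp hq =>
      rw [ring_add_lie, mul_add, ring_add_lie]
      exact add_mem hp
        hq
    | smul t p _ hp =>
      rw [ring_smul_lie, mul_smul_comm, ring_smul_lie]
      exact Submodule.smul_mem _ t hp
  | zero => simp [Ring.lie_def]
  | add p q _ _ hp hq =>
    rw [mul_add, ring_add_lie]
    exact add_mem hp
      hq
  | smul t p _ hp =>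
    rw [mul_smul_comm, ring_smul_lie]
    exact Submodule.smul_mem _ t hp

theorem lie_mul_mem_lieSeries (h2 : (2 : K) ≠ 0) (h3 : (3 : K) ≠ 0) {u : B}
    (hu : u ∈ lieSeries K B 2) (x : B) {k : ℕ} {l : B} (hl : l ∈ lieSeries K B k) :
    ⁅u * x, l⁆ ∈ lieSeries K B (k + 3) := by
  induction k generalizing l with
  | zero => exact lie_mul_mem_lieSeries_three h2 h3 hu x l
  | succ k ih =>
    induction hl using Submodule.span_induction with
    | mem w hw =>
      obtain ⟨v, hv, w, rfl⟩ := hw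
      have h : ⁅u * x, ⁅v, w⁆⁆ = ⁅⁅u * x, v⁆, w⁆ - ⁅⁅u * x, w⁆, v⁆ := by
        simp only [Ring.lie_def]; noncomm_ring
      rw [h]
      refine sub_mem (lie_mem_lieSeries (ih hv) w) ?_
      have := lieSeries_lie_lieSeries (lie_mul_mem_lieSeries_three h2 h3 hu x w) hv
      rwa [show 3 + k + 1 = k + 1 + 3 by ring] at this
    | zero => simp [Ring.lie_def]
    | add x y _ _ hx hy => rw [ring_lie_add]; exact add_mem hx hy
    | smul c x _ hx => rw [ring_lie_smul]; exact Submodule.smul_mem _ c hx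

/-! ### Products of the commutator ideals -/

/-- The two-sided ideal generated by the commutators of degree `k + 1`. -/
def commSeries (K B : Type*) [Field K] [Ring B] [Algebra K B] (k : ℕ) : Submodule K B :=
  lieSeries K B k * ⊤

theorem lieSeries_le_commSeries (k : ℕ) : lieSeries K B k ≤ commSeries K B k := fun u hu => by
  simpa [commSeries] using Submodule.mul_mem_mul hu (Submodule.mem_top (x := (1 : B)))

theorem commSeries_mul_mem {k : ℕ} {u : B} (hu : u ∈ commSeries K B k) (x : B) :
    u * x ∈ commSeries K B k := by
  have := Submodule.mul_mem_mul hu (Submodule.mem_top (x := x) (R := K))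
  rw [commSeries, mul_assoc] at this
  exact mul_le_mul_right (a := lieSeries K B k) (le_top (a := ⊤ * ⊤)) this

theorem mul_commSeries_mem {k : ℕ} {u : B} (hu : u ∈ commSeries K B k) (x : B) :
    x * u ∈ commSeries K B k := by
  induction hu using Submodule.mul_induction_on' with
  | mem_mul_mem l hl y _ =>
    have h : x * (l * y) = l * (x * y) + ⁅x, l⁆ * y := by
      simp only [Ring.lie_def]; noncomm_ring
    rw [h]
    exact add_mem (Submodule.mul_mem_mul hl trivial) <|
      Submodule.mul_mem_mul (lieSeries_succ_le _ (lie_mem_lieSeries' hl x)) trivial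
  | add p _ q _ hp hq => rw [mul_add]; exact add_mem hp hq

/-- The identity u[l, x] = -[ux, l] + [u, l]x turns a product into commutators whose degrees are
controlled by `lie_mul_mem_lieSeries`. -/
theorem commSeries_two_mul_le (h2 : (2 : K) ≠ 0) (h3 : (3 : K) ≠ 0) (k : ℕ) :
    commSeries K B 2 * commSeries K B k ≤ commSeries K B (k + 2) := by
  have key {u : B} (hu : u ∈ lieSeries K B 2) {w : B} (hw : w ∈ lieSeries K B k) :
      u * w ∈ commSeries K B (k + 2) := by
    cases k with
    | zero => exact Submodule.mul_mem_mul hu trivial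
    | succ k =>
      induction hw using Submodule.span_induction with
      | mem w hw =>
        obtain ⟨l, hl, x, rfl⟩ := hw
        have h : u * ⁅l, x⁆ = -⁅u * x, l⁆ + ⁅u, l⁆ * x := by
          simp only [Ring.lie_def]; noncomm_ring
        rw [h]
        refine add_mem (neg_mem (lieSeries_le_commSeries _ ?_)) (Submodule.mul_mem_mul ?_ trivial)
        · exact lie_mul_mem_lieSeries h2 h3 hu x hl
        · have := lieSeries_lie_lieSeries hu hl
          rwa [show 2 + k + 1 = k + 1 + 2 by ring] at this
      | zero => simp
      | add x y _ _ hx hy => rw [mul_add]; exact add_mem hx hy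
      | smul c x _ hx => rw [mul_smul_comm]; exact Submodule.smul_mem _ c hx
  refine Submodule.mul_le.2 fun p hp q hq => ?_
  induction hq using Submodule.mul_induction_on' with
  | add p _ q _ hp hq => rw [mul_add]; exact add_mem hp hq
  | mem_mul_mem w hw y _ =>
    rw [← mul_assoc]
    refine commSeries_mul_mem ?_ y
    induction hp using Submodule.mul_induction_on' with
    | add p _ q _ hp hq => rw [add_mul]; exact add_mem hp hq
    | mem_mul_mem u hu x _ =>
      have h : u * x * w = x * (u * w) + ⁅u, x⁆ * w := by
        simp only [Ring.lie_def]; noncomm_ring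
      rw [h]
      exact add_mem (mul_commSeries_mem (key hu hw) x)
        (key (lieSeries_succ_le _ (lie_mem_lieSeries hu x)) hw)

/-- Modulo `commSeries K B 2` commutators are central, so [a, b][c, d] is a derivation in each entry
and it suffices to take generators. Products with a shared entry vanish (`alt`), and two pairs
chosen from three generators always meet. -/
theorem lie_mul_lie_mem_of_rank_three {x y z : B} (hB : Algebra.adjoin K {x, y, z} = ⊤)
    (a b c d : B) : ⁅a, b⁆ * ⁅c, d⁆ ∈ commSeries K B 2 := by
  have m2 (p q r : B) : ⁅⁅p, q⁆, r⁆ ∈ commSeries K B 2 :=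
    lieSeries_le_commSeries _ (lie_mem_lieSeries (lie_mem_lieSeries (k := 0) trivial q) r)
  have alt (p q r : B) : ⁅p, q⁆ * ⁅r, q⁆ ∈ commSeries K B 2 := by
    have h : ⁅p, q⁆ * ⁅r, q⁆ = ⁅⁅p, q * r⁆, q⁆ - q * ⁅⁅p, r⁆, q⁆ - ⁅⁅p, q⁆, q⁆ * r := by
      simp only [Ring.lie_def]; noncomm_ring
    rw [h]
    exact sub_mem (sub_mem (m2 _ _ _) (mul_commSeries_mem (m2 _ _ _) _))
      (commSeries_mul_mem (m2 _ _ _) _)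
  have swapr {p q r s : B} (h : ⁅p, q⁆ * ⁅r, s⁆ ∈ commSeries K B 2) :
      ⁅p, q⁆ * ⁅s, r⁆ ∈ commSeries K B 2 := by
    rw [← ring_lie_skew s, mul_neg]; exact neg_mem h
  have swapl {p q r s : B} (h : ⁅p, q⁆ * ⁅r, s⁆ ∈ commSeries K B 2) :
      ⁅q, p⁆ * ⁅r, s⁆ ∈ commSeries K B 2 := by
    rw [← ring_lie_skew, neg_mul]; exact neg_mem h
  have comm {p q r s : B} (h : ⁅p, q⁆ * ⁅r, s⁆ ∈ commSeries K B 2) :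
      ⁅r, s⁆ * ⁅p, q⁆ ∈ commSeries K B 2 := by
    have e : ⁅r, s⁆ * ⁅p, q⁆ = ⁅p, q⁆ * ⁅r, s⁆ - ⁅⁅p, q⁆, ⁅r, s⁆⁆ := by
      rw [Ring.lie_def ⁅p, q⁆]; abel
    rw [e]
    exact sub_mem h (m2 _ _ _)
  have ext (b c d : B) (h : ∀ a ∈ ({x, y, z} : Set B), ⁅a, b⁆ * ⁅c, d⁆ ∈ commSeries K B 2)
      (a : B) : ⁅a, b⁆ * ⁅c, d⁆ ∈ commSeries K B 2 := by
    have ha : a ∈ Algebra.adjoin K {x, y, z} := hB ▸ trivial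
    induction ha using Algebra.adjoin_induction with
    | mem a ha => exact h a ha
    | algebraMap r => simp [Ring.lie_def, Algebra.commutes r b]
    | add p q _ _ hp hq => rw [ring_add_lie, add_mul]; exact add_mem hp hq
    | mul p q _ _ hp hq =>
      have e : ⁅p * q, b⁆ * ⁅c, d⁆
          = p * (⁅q, b⁆ * ⁅c, d⁆) + q * (⁅p, b⁆ * ⁅c, d⁆) + ⁅⁅p, b⁆, q⁆ * ⁅c, d⁆ := by
        simp only [Ring.lie_def]; noncomm_ring
      rw [e]
      exact add_mem (add_mem (mul_commSeries_mem hq p) (mul_commSeries_mem hp q))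
        (commSeries_mul_mem (m2 _ _ _) _)
  have gen (p q r s : B) (hp : p = x ∨ p = y ∨ p = z) (hq : q = x ∨ q = y ∨ q = z)
      (hr : r = x ∨ r = y ∨ r = z) (hs : s = x ∨ s = y ∨ s = z) :
      ⁅p, q⁆ * ⁅r, s⁆ ∈ commSeries K B 2 := by
    rcases eq_or_ne p q with rfl | hpq
    · simp [Ring.lie_def]
    rcases eq_or_ne r s with rfl | hrs
    · simp [Ring.lie_def]
    have : q = s ∨ p = s ∨ q = r ∨ p = r := by grind
    rcases this with rfl | rfl | rfl | rfl
    · exact alt _ _ _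
    · exact swapl (alt _ _ _)
    · exact swapr (alt _ _ _)
    · exact swapl (swapr (alt _ _ _))
  refine ext _ _ _ (fun a ha => ?_) a
  refine swapl <| ext _ _ _ (fun b hb => ?_) b
  refine comm <| ext _ _ _ (fun c hc => ?_) c
  refine swapl <| ext _ _ _ (fun d hd => ?_) d
  exact gen _ _ _ _ hd hc hb ha

theorem commutatorIdeal_le_commSeries : commutatorIdeal K B ≤ commSeries K B 1 := by
  let J : TwoSidedIdeal B := TwoSidedIdeal.mk' (commSeries K B 1) (zero_mem _) add_mem neg_mem
    (fun h => mul_commSeries_mem h _) (fun h => commSeries_mul_mem h _)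
  have hJ {b : B} : b ∈ J ↔ b ∈ commSeries K B 1 := TwoSidedIdeal.mem_mk' ..
  intro b hb
  have hb : b ∈ TwoSidedIdeal.span {c : B | ∃ a b : B, c = ⁅a, b⁆} := hb
  refine hJ.1 (TwoSidedIdeal.span_le.2 ?_ hb)
  rintro _ ⟨p, q, rfl⟩
  exact hJ.2 (lieSeries_le_commSeries _ (lie_mem_lieSeries (k := 0) trivial q))

theorem commSeries_one_mul_le {x y z : B} (hB : Algebra.adjoin K {x, y, z} = ⊤) :
    commSeries K B 1 * commSeries K B 1 ≤ commSeries K B 2 := by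
  have key {u : B} (hu : u ∈ lieSeries K B 1) {w : B} (hw : w ∈ lieSeries K B 1) :
      u * w ∈ commSeries K B 2 := by
    have := Submodule.mul_mem_mul hu hw
    rw [lieSeries, Submodule.span_mul_span] at this
    refine Submodule.span_le.2 ?_ this
    rintro _ ⟨_, ⟨a, -, b, rfl⟩, _, ⟨c, -, d, rfl⟩, rfl⟩
    exact lie_mul_lie_mem_of_rank_three hB a b c d
  refine Submodule.mul_le.2 fun p hp q hq => ?_
  induction hq using Submodule.mul_induction_on' with
  | add p _ q _ hp hq => rw [mul_add]; exact add_mem hp hq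
  | mem_mul_mem w hw y _ =>
    rw [← mul_assoc]
    refine commSeries_mul_mem ?_ y
    induction hp using Submodule.mul_induction_on' with
    | add p _ q _ hp hq => rw [add_mul]; exact add_mem hp hq
    | mem_mul_mem u hu x _ =>
      have h : u * x * w = x * (u * w) + ⁅u, x⁆ * w := by
        simp only [Ring.lie_def]; noncomm_ring
      rw [h]
      exact add_mem (mul_commSeries_mem (key hu hw) x)
        (key (lieSeries_succ_le _ (lie_mem_lieSeries hu x)) hw)

theorem commutatorIdeal_pow_le (h2 : (2 : K) ≠ 0) (h3 : (3 : K) ≠ 0) {x y z : B}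
    (hB : Algebra.adjoin K {x, y, z} = ⊤) (m : ℕ) :
    commutatorIdeal K B ^ m ≤ commSeries K B m := by
  induction m using Nat.twoStepInduction with
  | zero => exact fun b _ => lieSeries_le_commSeries 0 trivial
  | one => simpa using commutatorIdeal_le_commSeries
  | more m ih _ =>
    -- Two factors are split off at a time: their product lies in `commSeries K B 2`, which raises
    -- the index by two.
    rw [add_comm, pow_add, pow_two]
    refine (mul_le_mul' (mul_le_mul' commutatorIdeal_le_commSeries
      commutatorIdeal_le_commSeries) ih).trans ?_
    rw [add_comm]
    exact (mul_le_mul' (commSeries_one_mul_le hB) le_rfl).trans (commSeries_two_mul_le h2 h3 m)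

theorem commutatorIdeal_pow_eq_zero (h2 : (2 : K) ≠ 0) (h3 : (3 : K) ≠ 0) {x y z : B}
    (hB : Algebra.adjoin K {x, y, z} = ⊤) {m : ℕ} (h : ∀ a : ℕ → B, longComm a (m + 1) = 0) :
    commutatorIdeal K B ^ m = 0 := by
  have hL : lieSeries K B m = 0 := by
    refine le_bot_iff.1 ((lieSeries_le_span_longComm m).trans (Submodule.span_le.2 ?_))
    rintro _ ⟨a, rfl⟩
    exact h a
  have := commutatorIdeal_pow_le h2 h3 hB m
  rw [commSeries, hL, zero_mul] at this
  exact le_bot_iff.1 this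

end LieSeries

theorem map_longComm {A B : Type*} [Ring A] [Ring B] (φ : A →+* B) (a : ℕ → A) (n : ℕ) :
    φ (longComm a n) = longComm (φ ∘ a) n := by
  induction n using longComm.induct with
  | case1 => simp [longComm]
  | case2 => simp [longComm]
  | case3 n ih => simp [longComm, Ring.lie_def, ih]

/-! ### Lower bound: commutators divisible by a central element -/

section Deformation

variable {K A : Type*} [Field K] [Ring A] [Algebra K A] {ψ : FreeAlgebra K ℕ →ₐ[K] A} {H : A}

/-- The cofactor is kept in the image of ψ so that it can enter the next commutator and yield
another factor H. -/
theorem exists_map_lie_eq_mul (hH : ∀ f, Commute H (ψ f))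
    (hψ : ∀ k l : ℕ, ∃ e, ψ ⁅FreeAlgebra.ι K k, FreeAlgebra.ι K l⁆ = H * ψ e)
    (f g : FreeAlgebra K ℕ) : ∃ e, ψ ⁅f, g⁆ = H * ψ e := by
  have mul_step {p q g a b : FreeAlgebra K ℕ}
      (ha : ψ ⁅p, g⁆ = H * ψ a) (hb : ψ ⁅q, g⁆ = H * ψ b) :
      ψ ⁅p * q, g⁆ = H * ψ (a * q + p * b) := by
    have e : ⁅p * q, g⁆ = ⁅p, g⁆ * q + p * ⁅q, g⁆ := by
      simp only [Ring.lie_def]; noncomm_ring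
    rw [e, map_add, map_mul, map_mul, ha, hb, map_add, map_mul, map_mul, mul_add, mul_assoc,
      ← mul_assoc (ψ p), ← (hH p).eq, mul_assoc]
  have skew {p q : FreeAlgebra K ℕ} (h : ∃ e, ψ ⁅p, q⁆ = H * ψ e) :
      ∃ e, ψ ⁅q, p⁆ = H * ψ e := by
    obtain ⟨e, he⟩ := h
    exact ⟨-e, by rw [← ring_lie_skew, map_neg, he, map_neg, mul_neg]⟩
  have scalar (r : K) (g : FreeAlgebra K ℕ) :
      ∃ e, ψ ⁅algebraMap K (FreeAlgebra K ℕ) r, g⁆ = H * ψ e :=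
    ⟨0, by simp [Ring.lie_def, Algebra.commutes r (ψ g)]⟩
  have single (k : ℕ) (g : FreeAlgebra K ℕ) : ∃ e, ψ ⁅g, FreeAlgebra.ι K k⁆ = H * ψ e := by
    induction g using FreeAlgebra.induction with
    | grade0 r => exact scalar r _
    | grade1 l => exact hψ l k
    | mul a b ha hb =>
      obtain ⟨c, hc⟩ := ha
      obtain ⟨d, hd⟩ := hb
      exact ⟨_, mul_step hc hd⟩
    | add a b ha hb =>
      obtain ⟨c, hc⟩ := ha
      obtain ⟨d, hd⟩ := hb
      exact ⟨c + d, by rw [ring_add_lie, map_add, hc, hd, map_add, mul_add]⟩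
  induction f using FreeAlgebra.induction with
  | grade0 r => exact scalar r _
  | grade1 l => exact skew (single l g)
  | mul a b ha hb =>
    obtain ⟨c, hc⟩ := ha
    obtain ⟨d, hd⟩ := hb
    exact ⟨_, mul_step hc hd⟩
  | add a b ha hb =>
    obtain ⟨c, hc⟩ := ha
    obtain ⟨d, hd⟩ := hb
    exact ⟨c + d, by rw [ring_add_lie, map_add, hc, hd, map_add, mul_add]⟩

theorem exists_map_longComm_eq_pow_mul (hH : ∀ f, Commute H (ψ f))
    (hψ : ∀ k l : ℕ, ∃ e, ψ ⁅FreeAlgebra.ι K k, FreeAlgebra.ι K l⁆ = H * ψ e)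
    (a : ℕ → FreeAlgebra K ℕ) (n : ℕ) : ∃ e, ψ (longComm a (n + 1)) = H ^ n * ψ e := by
  induction n with
  | zero => exact ⟨a 0, by simp [longComm]⟩
  | succ n ih =>
    obtain ⟨e, he⟩ := ih
    obtain ⟨f, hf⟩ := exists_map_lie_eq_mul hH hψ e (a (n + 1))
    refine ⟨f, ?_⟩
    have hc := ((hH (a (n + 1))).pow_left n).eq
    rw [longComm, Ring.lie_def, map_sub, map_mul, map_mul, he, ← mul_assoc _ (H ^ n), ← hc,
      mul_assoc, mul_assoc, ← mul_sub, ← map_mul, ← map_mul, ← map_sub, ← Ring.lie_def, hf,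
      pow_succ, mul_assoc]

/-- If all commutators in the image of `ψ` are divisible by the central element `H`, then
`ψ` maps `T^{(n + 1)}` to multiples of `H ^ n`. -/
theorem exists_map_eq_pow_mul_of_mem (hH : ∀ f, Commute H (ψ f))
    (hψ : ∀ k l : ℕ, ∃ e, ψ ⁅FreeAlgebra.ι K k, FreeAlgebra.ι K l⁆ = H * ψ e) {n : ℕ}
    {f : FreeAlgebra K ℕ} (hf : f ∈ lieNilpTIdeal K (n + 1)) :
    ∃ e, ψ f = H ^ n * ψ e := by
  let J : TwoSidedIdeal (FreeAlgebra K ℕ) := TwoSidedIdeal.mk'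
    {f | ∃ e, ψ f = H ^ n * ψ e} ⟨0, by simp⟩
    (by
      rintro x y ⟨c, hc⟩ ⟨d, hd⟩
      exact ⟨c + d, by rw [map_add, hc, hd, map_add, mul_add]⟩)
    (by
      rintro x ⟨c, hc⟩
      exact ⟨-c, by rw [map_neg, hc, map_neg, mul_neg]⟩)
    (by
      rintro x y ⟨c, hc⟩
      refine ⟨x * c, ?_⟩
      rw [map_mul, hc, map_mul, ← mul_assoc, ← mul_assoc, ((hH x).pow_left n).eq])
    (by
      rintro x y ⟨c, hc⟩
      exact ⟨c * y, by rw [map_mul, hc, map_mul, mul_assoc]⟩)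
  have hJ {g : FreeAlgebra K ℕ} : g ∈ J ↔ ∃ e, ψ g = H ^ n * ψ e := TwoSidedIdeal.mem_mk' ..
  refine hJ.1 (TwoSidedIdeal.span_le.2 ?_ hf)
  rintro _ ⟨φ, rfl⟩
  refine hJ.2 ?_
  have := map_longComm (φ : FreeAlgebra K ℕ →+* FreeAlgebra K ℕ) (FreeAlgebra.ι K) (n + 1)
  rw [AlgHom.coe_toRingHom] at this
  rw [this]
  exact exists_map_longComm_eq_pow_mul hH hψ _ n

end Deformation

/-! ### The Weyl algebra representation on K[h][t] -/

section Weyl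

open Polynomial

/-- Multiplication by `h` on `K[h][t]`. -/
noncomputable def weylH (K : Type*) [Field K] : Module.End K K[X][X] :=
  LinearMap.mulLeft K (C X)

/-- The representation of the free algebra on `K[h][t]` in which the generators `i` and `j` act
by `h ∂/∂t` and `t`, and the other generators by `0`. -/
noncomputable def weylRep (K : Type*) [Field K] (i j : ℕ) :
    FreeAlgebra K ℕ →ₐ[K] Module.End K K[X][X] :=
  FreeAlgebra.lift K fun k =>
    if k = j then LinearMap.mulLeft K X
    else if k = i then weylH K * (derivative (R := K[X])).restrictScalars K else 0

variable {K : Type*} [Field K]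

theorem commute_weylH_weylRep (i j : ℕ) (f : FreeAlgebra K ℕ) :
    Commute (weylH K) (weylRep K i j f) := by
  induction f using FreeAlgebra.induction with
  | grade0 r => rw [AlgHom.commutes]; exact (Algebra.commutes r _).symm
  | grade1 k =>
    rw [weylRep, FreeAlgebra.lift_ι_apply]
    split_ifs with h₁ h₂
    · refine LinearMap.ext fun p => ?_
      simp [weylH, mul_left_comm]
    · refine LinearMap.ext fun p => ?_
      simp [weylH]
    · exact Commute.zero_right _
  | mul a b ha hb => rw [map_mul]; exact ha.mul_right hb
  | add a b ha hb => rw [map_add]; exact ha.add_right hb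

theorem weylRep_lie {i j : ℕ} (hij : i ≠ j) :
    weylRep K i j ⁅FreeAlgebra.ι K i, FreeAlgebra.ι K j⁆ = weylH K := by
  rw [Ring.lie_def, map_sub, map_mul, map_mul, weylRep, FreeAlgebra.lift_ι_apply,
    FreeAlgebra.lift_ι_apply, if_pos rfl, if_neg hij, if_pos rfl]
  refine LinearMap.ext fun p => ?_
  simp [weylH]
  ring

theorem exists_weylRep_lie_ι {i j : ℕ} (hij : i ≠ j) (k l : ℕ) :
    ∃ e, weylRep K i j ⁅FreeAlgebra.ι K k, FreeAlgebra.ι K l⁆ = weylH K * weylRep K i j e := by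
  by_cases hk : k = i ∧ l = j
  · obtain ⟨rfl, rfl⟩ := hk
    exact ⟨1, by rw [weylRep_lie hij, map_one, mul_one]⟩
  by_cases hl : k = j ∧ l = i
  · obtain ⟨rfl, rfl⟩ := hl
    refine ⟨-1, ?_⟩
    rw [← ring_lie_skew, map_neg, weylRep_lie hij, map_neg, map_one]
    exact LinearMap.ext fun p => by simp
  refine ⟨0, ?_⟩
  rw [Ring.lie_def, map_sub, map_mul, map_mul, weylRep, FreeAlgebra.lift_ι_apply,
    FreeAlgebra.lift_ι_apply, map_zero, mul_zero]
  split_ifs <;> first | simp | (exfalso; tauto)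

theorem lie_pow_notMem_lieNilpTIdeal {i j : ℕ} (hij : i ≠ j) (n : ℕ) :
    ⁅FreeAlgebra.ι K i, FreeAlgebra.ι K j⁆ ^ n ∉ lieNilpTIdeal K (n + 2) := by
  intro h
  obtain ⟨e, he⟩ := exists_map_eq_pow_mul_of_mem (ψ := weylRep K i j) (H := weylH K)
    (commute_weylH_weylRep i j) (exists_weylRep_lie_ι hij) h
  rw [map_pow, weylRep_lie hij] at he
  have hp (m : ℕ) (p : K[X][X]) : (weylH K ^ m) p = C X ^ m * p := by
    induction m with
    | zero => simp
    | succ m ih => rw [pow_succ', Module.End.mul_apply, ih, pow_succ', mul_assoc]; rfl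
  -- Evaluating at the polynomial 1 gives the impossible divisibility of h^n by h^(n+1).
  have h1 := LinearMap.congr_fun he 1
  rw [Module.End.mul_apply, hp, hp, mul_one] at h1
  have hd : (C X : K[X][X]) ^ (n + 1) ∣ C X ^ n := ⟨_, h1⟩
  rw [pow_dvd_pow_iff (C_ne_zero.2 X_ne_zero) (fun h => not_isUnit_X (isUnit_C.1 h))] at hd
  omega

end Weyl

/-! ### Transfer to the relatively free algebras -/

section RelFree

variable {K : Type*} [Field K]

theorem ringCon_mk'_eq_zero_iff {n : ℕ} {f : FreeAlgebra K ℕ} :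
    (lieNilpTIdeal K n).ringCon.mk' f = 0 ↔ f ∈ lieNilpTIdeal K n := by
  rw [TwoSidedIdeal.mem_iff, ← map_zero (lieNilpTIdeal K n).ringCon.mk']
  exact RingCon.eq _

theorem lie_relGen (n i j : ℕ) : ⁅relGen K n i, relGen K n j⁆
    = (lieNilpTIdeal K n).ringCon.mk' ⁅FreeAlgebra.ι K i, FreeAlgebra.ι K j⁆ := by
  rw [Ring.lie_def, Ring.lie_def, map_sub, map_mul, map_mul]; rfl

/-- Lifts of the entries to the free algebra define an endomorphism, under which the T-ideal is
closed by construction. -/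
theorem longComm_relFree (n : ℕ) (a : ℕ → RelFree K n) : longComm a n = 0 := by
  choose b hb using fun k => (lieNilpTIdeal K n).ringCon.mk'_surjective (a k)
  obtain rfl : (lieNilpTIdeal K n).ringCon.mk' ∘ b = a := funext hb
  rw [← map_longComm, ringCon_mk'_eq_zero_iff]
  refine TwoSidedIdeal.subset_span ⟨FreeAlgebra.lift K b, ?_⟩
  have := map_longComm (FreeAlgebra.lift K b : FreeAlgebra K ℕ →+* FreeAlgebra K ℕ)
    (FreeAlgebra.ι K) n
  rw [AlgHom.coe_toRingHom] at this
  rw [this]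
  congr 1
  exact funext fun k => (FreeAlgebra.lift_ι_apply b k).symm

/-- The elements x, y, z may coincide, so z = y covers two generators. -/
theorem commutatorIdeal_adjoin_pow_eq_zero (h2 : (2 : K) ≠ 0) (h3 : (3 : K) ≠ 0) (m : ℕ)
    (x y z : RelFree K (m + 1)) (S : Subalgebra K (RelFree K (m + 1)))
    (hS : S = Algebra.adjoin K {x, y, z}) : commutatorIdeal K S ^ m = 0 := by
  subst hS
  have hx : x ∈ Algebra.adjoin K {x, y, z} := Algebra.subset_adjoin (by simp)
  have hy : y ∈ Algebra.adjoin K {x, y, z} := Algebra.subset_adjoin (by simp)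
  have hz : z ∈ Algebra.adjoin K {x, y, z} := Algebra.subset_adjoin (by simp)
  refine commutatorIdeal_pow_eq_zero h2 h3 (x := ⟨x, hx⟩) (y := ⟨y, hy⟩) (z := ⟨z, hz⟩) ?_ ?_
  · rw [← Algebra.adjoin_adjoin_coe_preimage]
    congr 1
    ext w
    simp [Subtype.ext_iff]
  · intro a
    have := map_longComm (Algebra.adjoin K {x, y, z}).val.toRingHom a (m + 1)
    rw [longComm_relFree] at this
    exact Subtype.ext this

theorem lie_mem_commutatorIdeal {B : Type*} [Ring B] [Algebra K B] (x y : B) :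
    ⁅x, y⁆ ∈ commutatorIdeal K B :=
  TwoSidedIdeal.mem_asIdeal.2 (TwoSidedIdeal.subset_span ⟨x, y, rfl⟩)

theorem lie_relGen_pow_eq_zero (h2 : (2 : K) ≠ 0) (h3 : (3 : K) ≠ 0) (m i j : ℕ) :
    ⁅relGen K (m + 1) i, relGen K (m + 1) j⁆ ^ m = 0 := by
  set x := relGen K (m + 1) i
  set y := relGen K (m + 1) j
  have h := commutatorIdeal_adjoin_pow_eq_zero h2 h3 m x y y _ rfl
  have hx : x ∈ Algebra.adjoin K {x, y, y} := Algebra.subset_adjoin (by simp)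
  have hy : y ∈ Algebra.adjoin K {x, y, y} := Algebra.subset_adjoin (by simp)
  have := Submodule.pow_mem_pow _ (lie_mem_commutatorIdeal (K := K)
    (⟨x, hx⟩ : Algebra.adjoin K {x, y, y}) ⟨y, hy⟩) m
  rw [h] at this
  exact congrArg Subtype.val ((Submodule.mem_bot K).1 this)

theorem lie_relGen_pow_ne_zero {i j : ℕ} (hij : i ≠ j) (m : ℕ) :
    ⁅relGen K (m + 2) i, relGen K (m + 2) j⁆ ^ m ≠ 0 := by
  rw [lie_relGen, ← map_pow, Ne, ringCon_mk'_eq_zero_iff]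
  exact lie_pow_notMem_lieNilpTIdeal hij m

theorem commutatorIdeal_relFreeRank_pow_ne_zero {r : ℕ} (hr : 2 ≤ r) (m : ℕ) :
    commutatorIdeal K (relFreeRank K r (m + 2)) ^ m ≠ 0 := by
  intro h
  have hx (i : ℕ) (hi : i < 2) : relGen K (m + 2) i ∈ relFreeRank K r (m + 2) :=
    Algebra.subset_adjoin ⟨i, hi.trans_le hr, rfl⟩
  have := Submodule.pow_mem_pow _ (lie_mem_commutatorIdeal (K := K)
    (⟨_, hx 0 (by omega)⟩ : relFreeRank K r (m + 2)) ⟨_, hx 1 (by omega)⟩) m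
  rw [h] at this
  exact lie_relGen_pow_ne_zero zero_ne_one m (congrArg Subtype.val ((Submodule.mem_bot K).1 this))

end RelFree

theorem mainTheorem8 (K : Type*) [Field K] [Infinite K]
    (h2 : ringChar K ≠ 2) (h3 : ringChar K ≠ 3) (n : ℕ) (hn : 3 ≤ n) :
    (∀ i j : ℕ, i ≠ j →
      ⁅FreeAlgebra.ι K i, FreeAlgebra.ι K j⁆ ^ (n - 1) ∈ lieNilpTIdeal K n ∧
      ⁅FreeAlgebra.ι K i, FreeAlgebra.ι K j⁆ ^ (n - 2) ∉ lieNilpTIdeal K n ∧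
      nilpotencyClass ⁅relGen K n i, relGen K n j⁆ = n - 1) ∧
    (∀ r : ℕ, r = 2 ∨ r = 3 →
      nilpotencyClass (commutatorIdeal K (relFreeRank K r n)) = n - 1) := by
  have h2 : (2 : K) ≠ 0 := Ring.two_ne_zero h2
  have h3 : (3 : K) ≠ 0 := fun h => h3 <| by
    have hd : ringChar K ∣ 3 := ringChar.dvd (by exact_mod_cast h)
    exact ((Nat.dvd_prime Nat.prime_three).1 hd).resolve_left CharP.ringChar_ne_one
  obtain ⟨m, rfl⟩ : ∃ m, n = m + 2 := ⟨n - 2, by omega⟩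
  rw [show m + 2 - 1 = m + 1 by omega, show m + 2 - 2 = m by omega]
  refine ⟨fun i j hij => ⟨?_, lie_pow_notMem_lieNilpTIdeal hij m, ?_⟩, fun r hr => ?_⟩
  · rw [← ringCon_mk'_eq_zero_iff, map_pow, ← lie_relGen]
    exact lie_relGen_pow_eq_zero h2 h3 (m + 1) i j
  · rw [nilpotencyClass_eq_succ_iff]
    exact ⟨lie_relGen_pow_eq_zero h2 h3 (m + 1) i j, lie_relGen_pow_ne_zero hij m⟩
  · rw [nilpotencyClass_eq_succ_iff]
    refine ⟨?_, commutatorIdeal_relFreeRank_pow_ne_zero (by omega) m⟩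
    rcases hr with rfl | rfl
    · refine commutatorIdeal_adjoin_pow_eq_zero h2 h3 (m + 1) (relGen K _ 0) (relGen K _ 1)
        (relGen K _ 1) _ ?_
      rw [relFreeRank, show {i | i < 2} = ({0, 1, 1} : Set ℕ) by ext; simp; omega]
      simp only [Set.image_insert_eq, Set.image_singleton]
    · refine commutatorIdeal_adjoin_pow_eq_zero h2 h3 (m + 1) (relGen K _ 0) (relGen K _ 1)
        (relGen K _ 2) _ ?_
      rw [relFreeRank, show {i | i < 3} = ({0, 1, 2} : Set ℕ) by ext; simp; omega]
      simp only [Set.image_insert_eq, Set.image_singleton]
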